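/- A metric space $X$ is called straight if, whenever $X$ is the union of finitely many closed sets, a continuous function $f\colon X\to\mathbb{R}$ is uniformly continuous if and only if its restriction to each of these closed sets is uniformly continuous. It is called uniformly locally connected (ULC) if for every $\varepsilon>0$ there is $\delta>0$ such that any two points at distance less than $\delta$ lie in a connected set of diameter less than $\varepsilon$. It is called precompact if it is totally bounded. Let $\{X_i : i\in I\}$ be a countable (finite or countably infinite) family of non-empty metric spaces, and let $X=\prod_{i\in I}X_i$ carry the product uniformity, that is, the uniformity of the metric $d(x,y)=\sum_{i\in I}2^{-e(i)}\min\{1,d_i(x_i,y_i)\}$ for any injective $e\colon I\to\mathbb{N}$. If $X$ is straight, then every $X_i$ is straight and at least one of the following three cases occurs: (a) all $X_i$ are ULC and all but finitely many of them are connected (equivalently, $X$ is ULC); (b) all $X_i$ are precompact; (c) there is $j\in I$ such that $X_i$ is ULC and precompact for every $i\neq j$, and all but finitely many of the $X_i$ are connected. -/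

import Mathlib

open Set Filter Topology Uniformity

/-- A space is straight if, for every cover of it by finitely many closed sets, a continuous real
valued function is uniformly continuous if and only if its restriction to each of the closed sets
is uniformly continuous. Only the uniformity of the (metric) space enters. -/
def IsStraight (X : Type*) [UniformSpace X] : Prop :=
  ∀ 𝒞 : Set (Set X), 𝒞.Finite → (∀ C ∈ 𝒞, IsClosed C) → ⋃₀ 𝒞 = univ →
    ∀ f : X → ℝ, Continuous f →
      (UniformContinuous f ↔ ∀ C ∈ 𝒞, UniformContinuousOn f C)

/-- A space is uniformly locally connected (ULC) if any two sufficiently close points lie in a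
small connected set. The formulation by entourages applies to a product with its product
uniformity; `isULC_iff_metric` is the usual formulation in a metric space. -/
def IsULC (X : Type*) [UniformSpace X] : Prop :=
  ∀ U ∈ 𝓤 X, ∃ V ∈ 𝓤 X, ∀ x y : X, (x, y) ∈ V →
    ∃ C : Set X, IsConnected C ∧ x ∈ C ∧ y ∈ C ∧ C ×ˢ C ⊆ U

/-- In a metric space: for every `ε > 0` there is `δ > 0` such that any two points at distance
less than `δ` lie in a connected set of diameter less than `ε`. -/
theorem isULC_iff_metric (X : Type*) [MetricSpace X] :
    IsULC X ↔ ∀ ε : ℝ, 0 < ε → ∃ δ : ℝ, 0 < δ ∧ ∀ x y : X, dist x y < δ →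
      ∃ C : Set X, IsConnected C ∧ x ∈ C ∧ y ∈ C ∧ Metric.ediam C < ENNReal.ofReal ε := by
  constructor
  · intro h ε hε
    obtain ⟨V, hV, hVC⟩ := h _ (Metric.dist_mem_uniformity (half_pos hε))
    obtain ⟨δ, hδ, hδV⟩ := Metric.mem_uniformity_dist.1 hV
    refine ⟨δ, hδ, fun x y hxy => ?_⟩
    obtain ⟨C, hC, hx, hy, hCU⟩ := hVC x y (hδV hxy)
    refine ⟨C, hC, hx, hy, lt_of_le_of_lt (b := ENNReal.ofReal (ε / 2)) ?_ ?_⟩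
    · refine Metric.ediam_le fun a ha b hb => ?_
      rw [edist_dist]
      exact ENNReal.ofReal_le_ofReal (le_of_lt (hCU (mk_mem_prod ha hb)))
    · exact (ENNReal.ofReal_lt_ofReal_iff hε).2 (half_lt_self hε)
  · intro h U hU
    obtain ⟨ε, hε, hεU⟩ := Metric.mem_uniformity_dist.1 hU
    obtain ⟨δ, hδ, hC⟩ := h ε hε
    refine ⟨_, Metric.dist_mem_uniformity hδ, fun x y hxy => ?_⟩
    obtain ⟨C, hC, hx, hy, hd⟩ := hC x y hxy
    refine ⟨C, hC, hx, hy, ?_⟩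
    rintro ⟨a, b⟩ ⟨ha, hb⟩
    refine hεU ?_
    have h1 := lt_of_le_of_lt (Metric.edist_le_ediam_of_mem ha hb) hd
    rw [edist_dist] at h1
    exact (ENNReal.ofReal_lt_ofReal_iff hε).1 h1

/-- The product uniformity of a countable family of metric spaces, which Mathlib puts on
`∀ i, X i`, is the uniformity of the usual product metric
`d (x, y) = ∑ i, 2 ^ (- e i) * min 1 (d (x i, y i))`, for any enumeration `e` of the indices. -/
theorem hasBasis_uniformity_pi_productMetric {I : Type*} {X : I → Type*}
    [∀ i, MetricSpace (X i)] (e : I → ℕ) (he : Function.Injective e) :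
    (𝓤 (∀ i, X i)).HasBasis (fun ε : ℝ => 0 < ε) (fun ε =>
      {p | ∑' i, (1 / 2 : ℝ) ^ e i * min 1 (dist (p.1 i) (p.2 i)) < ε}) := by
  have hs : Summable fun i => (1 / 2 : ℝ) ^ e i := summable_geometric_two.comp_injective he
  have h0 : ∀ (p : (∀ i, X i) × (∀ i, X i)) (i : I),
      0 ≤ (1 / 2 : ℝ) ^ e i * min 1 (dist (p.1 i) (p.2 i)) := fun p i => by positivity
  have h1 : ∀ (p : (∀ i, X i) × (∀ i, X i)) (i : I),
      (1 / 2 : ℝ) ^ e i * min 1 (dist (p.1 i) (p.2 i)) ≤ (1 / 2 : ℝ) ^ e i := fun p i =>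
    mul_le_of_le_one_right (by positivity) (min_le_left _ _)
  have ht : Tendsto (fun p : (∀ i, X i) × (∀ i, X i) =>
      ∑' i, (1 / 2 : ℝ) ^ e i * min 1 (dist (p.1 i) (p.2 i))) (𝓤 (∀ i, X i)) (𝓝 0) := by
    have : Tendsto (fun p : (∀ i, X i) × (∀ i, X i) =>
        ∑' i, (1 / 2 : ℝ) ^ e i * min 1 (dist (p.1 i) (p.2 i))) (𝓤 (∀ i, X i))
        (𝓝 (∑' _ : I, (0 : ℝ))) := by
      refine tendsto_tsum_of_dominated_convergence hs (fun i => ?_)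
        (Eventually.of_forall fun p i => ?_)
      · have hd : Tendsto (fun p : (∀ i, X i) × (∀ i, X i) => dist (p.1 i) (p.2 i))
            (𝓤 (∀ i, X i)) (𝓝 0) := by
          have hp : Tendsto (fun p : (∀ i, X i) × (∀ i, X i) => (p.1 i, p.2 i))
            (𝓤 (∀ i, X i)) (𝓤 (X i)) := Pi.uniformContinuous_proj X i
          rw [Metric.uniformity_eq_comap_nhds_zero, tendsto_comap_iff] at hp
          exact hp
        simpa using (tendsto_const_nhds (x := (1 : ℝ)).min hd).const_mul ((1 / 2 : ℝ) ^ e i)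
      · rw [Real.norm_of_nonneg (h0 p i)]
        exact h1 p i
    simpa using this
  refine ⟨fun s => ⟨fun hsU => ?_, ?_⟩⟩
  · have hb : (⨅ ε ∈ Ioi (0 : ℝ), 𝓟 {p : (∀ i, X i) × (∀ i, X i) |
        ∑' i, (1 / 2 : ℝ) ^ e i * min 1 (dist (p.1 i) (p.2 i)) < ε}) ≤ 𝓤 (∀ i, X i) := by
      rw [Pi.uniformity]
      refine le_iInf fun i => ?_
      rw [← tendsto_iff_comap, Metric.uniformity_basis_dist.tendsto_right_iff]
      intro ε hε
      have hc : 0 < (1 / 2 : ℝ) ^ e i * min 1 ε := by positivity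
      refine mem_iInf_of_mem _ (mem_iInf_of_mem (mem_Ioi.2 hc) ?_)
      rw [mem_principal]
      intro p hp
      have h2 := lt_of_le_of_lt ((Summable.of_nonneg_of_le (h0 p) (h1 p) hs).le_tsum i
        fun j _ => h0 p j) hp
      have h3 := lt_of_mul_lt_mul_left h2 (by positivity)
      rcases min_lt_iff.1 h3 with h4 | h4
      · exact absurd h4 (not_lt.2 (min_le_left _ _))
      · exact lt_of_lt_of_le h4 (min_le_right _ _)
    have := hb hsU
    rw [mem_biInf_of_directed] at this
    · obtain ⟨ε, hε, h⟩ := this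
      exact ⟨ε, hε, h⟩
    · intro a ha b hb
      refine ⟨min a b, mem_Ioi.2 (lt_min ha hb), ?_, ?_⟩
      · exact principal_mono.2 fun p hp => lt_of_lt_of_le (b := min a b) hp (min_le_left a b)
      · exact principal_mono.2 fun p hp => lt_of_lt_of_le (b := min a b) hp (min_le_right a b)
    · exact ⟨1, mem_Ioi.2 one_pos⟩
  · rintro ⟨ε, hε, h⟩
    exact mem_of_superset (ht.eventually (gt_mem_nhds hε)) h

/-! Each factor is a uniform retract of the product, hence straight. For the trichotomy the key is
`IsStraight.isULC_of_not_totallyBounded`: if `A × B` is straight and `A` is not precompact, then `B`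
is ULC. Otherwise arbitrarily close pairs in `B` are separated by relatively clopen pieces of balls
of one fixed radius. Placing these pieces over a uniformly separated sequence of `A` gives two
closed sets covering `A × B` that have close points far from their intersection, which
`IsStraight.exists_dist_inter_lt` forbids.

If some `X j` is not precompact, the product of the other factors is therefore ULC, and
`isULC_pi_iff` reads this off coordinatewise. If `X j` is ULC too, case (a) holds; if not, a second
non-precompact factor would force `X j` to be ULC, so case (c) holds. -/

/-! ### Uniform retracts -/

/-- Straightness passes to uniform retracts. -/
theorem IsStraight.of_retract {A B : Type*} [UniformSpace A] [UniformSpace B]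
    (hB : IsStraight B) {s : A → B} {p : B → A} (hs : UniformContinuous s)
    (hp : UniformContinuous p) (hps : ∀ a, p (s a) = a) : IsStraight A := by
  intro 𝒞 hfin hcl hun f hf
  refine ⟨fun h C _ => h.uniformContinuousOn, fun h => ?_⟩
  have key : UniformContinuous (f ∘ p) := by
    refine (hB ((fun C => p ⁻¹' C) '' 𝒞) (hfin.image _) ?_ ?_ (f ∘ p)
      (hf.comp hp.continuous)).2 ?_
    · rintro _ ⟨C, hC, rfl⟩
      exact (hcl C hC).preimage hp.continuous
    · refine eq_univ_of_forall fun b => ?_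
      obtain ⟨C, hC, hb⟩ : p b ∈ ⋃₀ 𝒞 := hun ▸ mem_univ _
      exact ⟨_, ⟨C, hC, rfl⟩, hb⟩
    · rintro _ ⟨C, hC, rfl⟩
      exact (h C hC).comp hp.uniformContinuousOn (mapsTo_preimage p C)
  have := key.comp hs
  have he : (f ∘ p) ∘ s = f := funext fun a => congrArg f (hps a)
  rwa [he] at this

/-- Uniform local connectedness passes to uniform retracts. -/
theorem IsULC.of_retract {A B : Type*} [UniformSpace A] [UniformSpace B]
    (hB : IsULC B) {s : A → B} {p : B → A} (hs : UniformContinuous s)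
    (hp : UniformContinuous p) (hps : ∀ a, p (s a) = a) : IsULC A := by
  intro U hU
  obtain ⟨V, hV, h⟩ := hB _ (hp hU)
  refine ⟨_, hs hV, fun x y hxy => ?_⟩
  obtain ⟨C, hC, hx, hy, hCU⟩ := h _ _ hxy
  refine ⟨p '' C, hC.image p hp.continuous.continuousOn, ⟨_, hx, hps x⟩, ⟨_, hy, hps y⟩, ?_⟩
  rintro ⟨_, _⟩ ⟨⟨a, ha, rfl⟩, ⟨b, hb, rfl⟩⟩
  exact hCU (mk_mem_prod ha hb)

/-! ### Closed covers and clopen pieces of balls -/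

/-- In a straight space, two closed sets covering the space are uniformly placed: close points of
the two sets are close to their intersection. -/
theorem IsStraight.exists_dist_inter_lt {Z : Type*} [PseudoMetricSpace Z] (hZ : IsStraight Z)
    {C D : Set Z} (hC : IsClosed C) (hD : IsClosed D) (hCD : C ∪ D = univ) {ρ : ℝ} (hρ : 0 < ρ) :
    ∃ δ > 0, ∀ a ∈ C, ∀ b ∈ D, dist a b < δ → ∃ z ∈ C ∩ D, dist a z < ρ := by
  classical
  obtain ⟨g, hg, hg0, hgρ⟩ : ∃ g : Z → ℝ, UniformContinuous g ∧ (∀ z ∈ C ∩ D, g z = 0) ∧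
      ∀ a, g a < ρ → ∃ z ∈ C ∩ D, dist a z < ρ := by
    -- `infDist` to the empty set is `0` by convention, so an empty intersection needs a constant
    -- instead.
    rcases (C ∩ D).eq_empty_or_nonempty with he | hne
    · refine ⟨fun _ => ρ, uniformContinuous_const, ?_, fun a h => absurd h (lt_irrefl _)⟩
      simp [he]
    · exact ⟨fun z => Metric.infDist z (C ∩ D), Metric.uniformContinuous_infDist_pt _,
        fun z hz => Metric.infDist_zero_of_mem hz, fun a h => (Metric.infDist_lt_iff hne).1 h⟩
  -- Glue `g` on `C` to `0` on `D`: they agree on `C ∩ D`, and uniform continuity of `f` bounds `g`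
  -- at points of `C` close to `D`.
  set f : Z → ℝ := fun z => if z ∈ C then g z else 0 with hf
  have hfC : ∀ z ∈ C, f z = g z := fun z hz => if_pos hz
  have hfD : ∀ z ∈ D, f z = 0 := fun z hz => by
    by_cases h : z ∈ C
    · rw [hfC z h, hg0 z ⟨h, hz⟩]
    · exact if_neg h
  have huC : UniformContinuousOn f C := hg.uniformContinuousOn.congr fun z hz => (hfC z hz).symm
  have huD : UniformContinuousOn f D :=
    (uniformContinuous_const (b := (0 : ℝ))).uniformContinuousOn.congr
      fun z hz => (hfD z hz).symm
  have hfc : Continuous f := by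
    rw [← continuousOn_univ, ← hCD]
    exact huC.continuousOn.union_of_isClosed huD.continuousOn hC hD
  have hfu : UniformContinuous f := by
    refine (hZ {C, D} (toFinite _) ?_ (by simpa using hCD) f hfc).2 ?_
    · rintro _ (rfl | rfl) <;> assumption
    · rintro _ (rfl | rfl) <;> assumption
  obtain ⟨δ, hδ, h⟩ := Metric.uniformContinuous_iff.1 hfu ρ hρ
  refine ⟨δ, hδ, fun a ha b hb hab => hgρ a ?_⟩
  have := h hab
  rw [hfC a ha, hfD b hb, Real.dist_eq, sub_zero] at this
  exact (le_abs_self _).trans_lt this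

/-- If points that are close enough to the centre of a ball are never separated from it by a
relatively clopen subset of the ball, then the space is ULC. -/
theorem isULC_of_forall_clopen_ball {Y : Type*} [PseudoMetricSpace Y]
    (H : ∀ r > (0 : ℝ), ∃ δ > 0, ∀ a b : Y, dist b a < δ → ∀ P ⊆ Metric.ball a r,
      IsOpen P → IsOpen (Metric.ball a r \ P) → a ∈ P → b ∈ P) : IsULC Y := by
  intro U hU
  obtain ⟨ε, hε, hεU⟩ := Metric.mem_uniformity_dist.1 hU
  obtain ⟨δ, hδ, hH⟩ := H (ε / 2) (half_pos hε)
  refine ⟨_, Metric.dist_mem_uniformity hδ, fun a b hab => ?_⟩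
  set B := Metric.ball a (ε / 2) with hB
  have haB : a ∈ B := Metric.mem_ball_self (half_pos hε)
  -- The quasi-component of `a` in `B`. It turns out clopen in `B`, so splitting it would give a
  -- smaller clopen set around `a`; hence it is connected.
  set C : Set Y := {y | ∀ P ⊆ B, IsOpen P → IsOpen (B \ P) → a ∈ P → y ∈ P} with hCdef
  have haC : a ∈ C := fun P _ _ _ h => h
  have hbC : b ∈ C := fun P h1 h2 h3 h4 => hH a b (by rw [dist_comm]; exact hab) P h1 h2 h3 h4
  have hCB : C ⊆ B := fun y hy => hy B Subset.rfl Metric.isOpen_ball (by simp) haB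
  have hCo : IsOpen C := by
    rw [Metric.isOpen_iff]
    intro y hy
    obtain ⟨r, hr, hrB⟩ := Metric.isOpen_iff.1 Metric.isOpen_ball y (hCB hy)
    obtain ⟨η, hη, hηH⟩ := H r hr
    refine ⟨η, hη, fun z hz P h1 h2 h3 h4 => ?_⟩
    -- A clopen piece of `B` cuts the smaller ball around `y` in a clopen piece, so `H` applies
    -- there with `η` independent of `P`.
    refine (hηH y z hz (P ∩ Metric.ball y r) inter_subset_right (h2.inter Metric.isOpen_ball) ?_
      ⟨hy P h1 h2 h3 h4, Metric.mem_ball_self hr⟩).1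
    have : Metric.ball y r \ (P ∩ Metric.ball y r) = (B \ P) ∩ Metric.ball y r := by
      ext w
      simp only [Set.mem_sdiff, mem_inter_iff]
      exact ⟨fun h => ⟨⟨hrB h.1, fun hp => h.2 ⟨hp, h.1⟩⟩, h.1⟩, fun h => ⟨h.2, fun hp => h.1.2 hp.1⟩⟩
    rw [this]
    exact h3.inter Metric.isOpen_ball
  have hBC : IsOpen (B \ C) := by
    rw [isOpen_iff_forall_mem_open]
    rintro y ⟨hyB, hyC⟩
    simp only [hCdef, mem_ofPred_eq, not_forall] at hyC
    obtain ⟨P, h1, h2, h3, h4, h5⟩ := hyC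
    exact ⟨B \ P, fun z hz => ⟨hz.1, fun hzC => hz.2 (hzC P h1 h2 h3 h4)⟩, h3, hyB, h5⟩
  have hside : ∀ u v : Set Y, IsOpen u → IsOpen v → C ⊆ u ∪ v → ¬ (C ∩ (u ∩ v)).Nonempty →
      a ∈ u → C ⊆ u := by
    intro u v hu hv huv hd hau y hy
    refine (hy (C ∩ u) (inter_subset_left.trans hCB) (hCo.inter hu) ?_ ⟨haC, hau⟩).2
    have : B \ (C ∩ u) = (B \ C) ∪ (C ∩ v) := by
      ext w
      constructor
      · rintro ⟨hw, hn⟩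
        by_cases hwC : w ∈ C
        · exact Or.inr ⟨hwC, (huv hwC).resolve_left fun hwu => hn ⟨hwC, hwu⟩⟩
        · exact Or.inl ⟨hw, hwC⟩
      · rintro (⟨hw, hn⟩ | ⟨hw, hwv⟩)
        · exact ⟨hw, fun h => hn h.1⟩
        · exact ⟨hCB hw, fun h => hd ⟨w, hw, h.2, hwv⟩⟩
    rw [this]
    exact hBC.union (hCo.inter hv)
  refine ⟨C, ⟨⟨a, haC⟩, ?_⟩, haC, hbC, ?_⟩
  · rintro u v hu hv huv ⟨x, hxC, hxu⟩ ⟨y, hyC, hyv⟩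
    by_contra hd
    rcases huv haC with hau | hav
    · exact hd ⟨y, hyC, hside u v hu hv huv hd hau hyC, hyv⟩
    · exact hd ⟨x, hxC, hxu, hside v u hv hu (by rwa [union_comm]) (by rwa [inter_comm v u]) hav hxC⟩
  · rintro ⟨x, y⟩ ⟨hx, hy⟩
    refine hεU ?_
    have h1 := Metric.mem_ball.1 (hCB hx)
    have h2 := Metric.mem_ball'.1 (hCB hy)
    linarith [dist_triangle x a y]

theorem exists_separated_seq_of_not_totallyBounded {A : Type*} [PseudoMetricSpace A]
    (hA : ¬ TotallyBounded (univ : Set A)) :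
    ∃ ε > 0, ∃ u : ℕ → A, ∀ m n, dist (u m) (u n) < ε → m = n := by
  rw [Metric.totallyBounded_iff] at hA
  push Not at hA
  obtain ⟨ε, hε, h⟩ := hA
  have h' : ∀ t : Set A, t.Finite → ∃ c, ∀ y ∈ t, ε ≤ dist c y := by
    intro t ht
    obtain ⟨c, -, hc⟩ := not_subset.1 (h t ht)
    refine ⟨c, fun y hy => ?_⟩
    by_contra hlt
    exact hc (mem_biUnion hy (not_le.1 hlt))
  obtain ⟨u, hu⟩ := seq_of_forall_finite_exists h'
  refine ⟨ε, hε, u, fun m n hmn => ?_⟩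
  rcases lt_trichotomy m n with hlt | heq | hlt
  · exact absurd (hu n _ (mem_image_of_mem u hlt)) (not_le.2 (by rwa [dist_comm]))
  · exact heq
  · exact absurd (hu m _ (mem_image_of_mem u hlt)) (not_le.2 hmn)

/-- If a product of two spaces is straight and one factor is not precompact, then the other
factor is ULC. -/
theorem IsStraight.isULC_of_not_totallyBounded {A B : Type*} [PseudoMetricSpace A]
    [PseudoMetricSpace B] (hAB : IsStraight (A × B)) (hA : ¬ TotallyBounded (univ : Set A)) :
    IsULC B := by
  obtain ⟨ε, hε, x, hx⟩ := exists_separated_seq_of_not_totallyBounded hA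
  by_contra hB
  replace hB := mt isULC_of_forall_clopen_ball hB
  push Not at hB
  obtain ⟨r, hr, hB⟩ := hB
  have hδ : ∀ n : ℕ, 0 < min r (1 / ((n : ℝ) + 1)) := fun n => lt_min hr Nat.one_div_pos_of_nat
  choose a b hab P hPB hPo hBP haP hbP using fun n : ℕ => hB _ (hδ n)
  -- `C` and `Eᶜ` are the two closed sets: `(x n, a n)` lies in `C`, the nearby `(x n, b n)` in
  -- `Eᶜ`.
  set C : Set (A × B) := ⋃ n, Metric.closedBall (x n) (ε / 4) ×ˢ closure (P n) with hCdef
  set E : Set (A × B) := ⋃ n, Metric.ball (x n) (ε / 4) ×ˢ P n with hEdef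
  have hE : IsOpen E := isOpen_iUnion fun n => Metric.isOpen_ball.prod (hPo n)
  have hC : IsClosed C := by
    -- Radius `ε / 4`: two slabs meeting the same `ε / 4`-ball have centres less than `ε` apart, so
    -- they coincide.
    refine LocallyFinite.isClosed_iUnion (fun z => ?_)
      fun n => Metric.isClosed_closedBall.prod isClosed_closure
    refine ⟨Metric.ball z.1 (ε / 4) ×ˢ univ, prod_mem_nhds
      (Metric.ball_mem_nhds _ (by positivity)) univ_mem, Set.Subsingleton.finite ?_⟩
    rintro m ⟨w, ⟨hwm, -⟩, ⟨hwz, -⟩⟩ n ⟨w', ⟨hwn, -⟩, ⟨hwz', -⟩⟩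
    refine hx m n ?_
    have h1 := Metric.mem_closedBall'.1 hwm
    have h2 := Metric.mem_ball.1 hwz
    have h3 := Metric.mem_closedBall.1 hwn
    have h4 := Metric.mem_ball'.1 hwz'
    linarith [dist_triangle4 (x m) w.1 z.1 (x n), dist_triangle z.1 w'.1 (x n)]
  have hCE : C ∪ Eᶜ = univ := by
    refine eq_univ_of_forall fun z => (em (z ∈ E)).imp (fun hz => ?_) id
    obtain ⟨n, hn⟩ := mem_iUnion.1 hz
    exact mem_iUnion.2 ⟨n, Metric.ball_subset_closedBall hn.1, subset_closure hn.2⟩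
  obtain ⟨δ, hδ0, h⟩ := hAB.exists_dist_inter_lt hC hE.isClosed_compl hCE
    (lt_min (by positivity : 0 < ε / 4) hr)
  obtain ⟨n, hn⟩ := exists_nat_one_div_lt hδ0
  obtain ⟨z, ⟨hzC, hzE⟩, hz⟩ := h (x n, a n)
    (mem_iUnion.2 ⟨n, Metric.mem_closedBall_self (by positivity), subset_closure (haP n)⟩)
    (x n, b n) (fun hmem => by
      obtain ⟨m, hm1, hm2⟩ := mem_iUnion.1 hmem
      obtain rfl := hx n m ((Metric.mem_ball.1 hm1).trans (by linarith))
      exact hbP _ hm2)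
    (by
      rw [dist_prod_same_left, dist_comm]
      exact (hab n).trans_le ((min_le_right _ _).trans hn.le))
  obtain ⟨m, hm1, hm2⟩ := mem_iUnion.1 hzC
  rw [Prod.dist_eq, max_lt_iff] at hz
  have hz1 : dist (x n) z.1 < ε / 4 := hz.1.trans_le (min_le_left _ _)
  have hz2 : dist (a n) z.2 < r := hz.2.trans_le (min_le_right _ _)
  obtain rfl := hx n m (by
    linarith [dist_triangle (x n) z.1 (x m), Metric.mem_closedBall.1 hm1])
  refine hzE (mem_iUnion.2 ⟨n, Metric.mem_ball'.2 hz1, ?_⟩)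
  -- `P n` is relatively closed in its ball, so its closure adds no point there.
  by_contra hzP
  obtain ⟨w, hw, hwP⟩ := mem_closure_iff.1 hm2 _ (hBP n) ⟨Metric.mem_ball'.2 hz2, hzP⟩
  exact hw.2 hwP

/-! ### Uniform local connectedness of products -/

theorem uniformContinuous_pi_update {I : Type*} [DecidableEq I] {X : I → Type*}
    [∀ i, UniformSpace (X i)] (x : ∀ i, X i) (i : I) :
    UniformContinuous (Function.update x i) := by
  rw [uniformContinuous_pi]
  intro k
  by_cases h : k = i
  · subst h
    simpa using! uniformContinuous_id
  · simpa [h] using uniformContinuous_const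

/-- A product of non-empty spaces is ULC if and only if all factors are ULC and all but finitely
many of them are connected. -/
theorem isULC_pi_iff {I : Type*} {X : I → Type*} [∀ i, UniformSpace (X i)]
    [∀ i, Nonempty (X i)] :
    IsULC (∀ i, X i) ↔ (∀ i, IsULC (X i)) ∧ {i | ¬ ConnectedSpace (X i)}.Finite := by
  classical
  have hbasis := HasBasis.iInf' fun i =>
    ((𝓤 (X i)).basis_sets.comap fun p : (∀ i, X i) × (∀ i, X i) => (p.1 i, p.2 i))
  rw [← Pi.uniformity] at hbasis
  constructor
  · intro h
    have x : ∀ i, X i := fun i => Classical.arbitrary _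
    refine ⟨fun i => h.of_retract (uniformContinuous_pi_update x i)
      (Pi.uniformContinuous_proj X i) fun a => by simp, ?_⟩
    -- `V` constrains only the finitely many coordinates in `F`; off `F`, any two points of a factor
    -- extend to `V`-close points, so a connected set joins them.
    obtain ⟨V, hV, hVC⟩ := h univ univ_mem
    obtain ⟨⟨F, W⟩, ⟨hF, hW⟩, hFW⟩ := hbasis.mem_iff.1 hV
    refine hF.subset fun i hi => ?_
    by_contra hiF
    refine hi ?_
    have hpre : IsPreconnected (univ : Set (X i)) := by
      refine isPreconnected_of_forall_pair fun p _ q _ => ?_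
      obtain ⟨C, hC, hp, hq, -⟩ := hVC (Function.update x i p) (Function.update x i q) (hFW (by
        simp only [mem_iInter]
        intro k hk
        have hki : k ≠ i := fun hh => hiF (hh ▸ hk)
        simpa [hki] using refl_mem_uniformity (hW k hk)))
      exact ⟨(fun y => y i) '' C, subset_univ _, ⟨_, hp, by simp⟩, ⟨_, hq, by simp⟩,
        hC.isPreconnected.image _ (continuous_apply i).continuousOn⟩
    exact { isPreconnected_univ := hpre, toNonempty := inferInstance }
  · rintro ⟨hU, hfin⟩ U hUmem
    obtain ⟨⟨F, W⟩, ⟨hF, hW⟩, hFW⟩ := hbasis.mem_iff.1 hUmem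
    -- `W i` is known to be an entourage only for `i ∈ F`.
    have hloc : ∀ i, ∃ V ∈ 𝓤 (X i), ∀ x y : X i, (x, y) ∈ V →
        ∃ C : Set (X i), IsConnected C ∧ x ∈ C ∧ y ∈ C ∧ (i ∈ F → C ×ˢ C ⊆ W i) := by
      intro i
      by_cases hi : i ∈ F
      · obtain ⟨V, hV, h⟩ := hU i (W i) (hW i hi)
        refine ⟨V, hV, fun x y hxy => ?_⟩
        obtain ⟨C, h1, h2, h3, h4⟩ := h x y hxy
        exact ⟨C, h1, h2, h3, fun _ => h4⟩
      · obtain ⟨V, hV, h⟩ := hU i univ univ_mem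
        refine ⟨V, hV, fun x y hxy => ?_⟩
        obtain ⟨C, h1, h2, h3, -⟩ := h x y hxy
        exact ⟨C, h1, h2, h3, fun h => absurd h hi⟩
    choose V hV hVC using hloc
    refine ⟨_, hbasis.mem_of_mem (i := (F ∪ {i | ¬ ConnectedSpace (X i)}, V))
      ⟨hF.union hfin, fun i _ => hV i⟩, fun x y hxy => ?_⟩
    have hcoord : ∀ i, ∃ C : Set (X i), IsConnected C ∧ x i ∈ C ∧ y i ∈ C ∧
        (i ∈ F → C ×ˢ C ⊆ W i) := by
      intro i
      by_cases hi : i ∈ F ∪ {i | ¬ ConnectedSpace (X i)}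
      · exact hVC i _ _ (mem_iInter₂.1 hxy i hi)
      · have hcon : ConnectedSpace (X i) := by
          by_contra hc
          exact hi (Or.inr hc)
        exact ⟨univ, isConnected_univ, mem_univ _, mem_univ _, fun h => absurd (Or.inl h) hi⟩
    choose C hC hxC hyC hCW using hcoord
    refine ⟨univ.pi C, isConnected_univ_pi.2 hC, fun i _ => hxC i, fun i _ => hyC i, ?_⟩
    rintro ⟨p, q⟩ ⟨hp, hq⟩
    exact hFW (mem_iInter₂.2 fun i hi => hCW i hi ⟨hp i trivial, hq i trivial⟩)

/-! ### Straight countable products -/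

/-- If a countable product is straight and the factor at `j` is not precompact, then the product
of the other factors is ULC. -/
theorem IsStraight.isULC_pi_ne {I : Type*} [Countable I] {X : I → Type*}
    [∀ i, PseudoMetricSpace (X i)] (hX : IsStraight (∀ i, X i)) {j : I}
    (hj : ¬ TotallyBounded (univ : Set (X j))) : IsULC (∀ i : {i // i ≠ j}, X i) := by
  classical
  -- Countability makes the product uniformity pseudometrizable, as the two-factor lemma requires.
  let _ : PseudoMetricSpace (∀ i : {i // i ≠ j}, X i) := UniformSpace.pseudoMetricSpace _
  refine IsStraight.isULC_of_not_totallyBounded (A := X j) (hX.of_retract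
    (s := fun p i => if h : i = j then h ▸ p.1 else p.2 ⟨i, h⟩)
    (p := fun x => (x j, fun i => x i)) ?_ ?_ ?_) hj
  · rw [uniformContinuous_pi]
    intro i
    by_cases h : i = j
    · subst h
      simpa using uniformContinuous_fst
    · simpa [h, Function.comp_def] using (Pi.uniformContinuous_proj
        (fun i : {i // i ≠ j} => X i) ⟨i, h⟩).comp uniformContinuous_snd
  · exact (Pi.uniformContinuous_proj X j).prodMk
      (uniformContinuous_pi.2 fun i => Pi.uniformContinuous_proj X i)
  · rintro ⟨p, q⟩
    refine Prod.ext (by simp) (funext fun i => ?_)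
    simp [i.2]

theorem proposition6p7 {I : Type*} [Countable I] (X : I → Type*) [∀ i, MetricSpace (X i)]
    [∀ i, Nonempty (X i)] (hX : IsStraight (∀ i, X i)) :
    (∀ i, IsStraight (X i)) ∧
    (((∀ i, IsULC (X i)) ∧ {i | ¬ ConnectedSpace (X i)}.Finite) ↔ IsULC (∀ i, X i)) ∧
    (((∀ i, IsULC (X i)) ∧ {i | ¬ ConnectedSpace (X i)}.Finite) ∨
      (∀ i, TotallyBounded (univ : Set (X i))) ∨
      (∃ j, (∀ i, i ≠ j → IsULC (X i) ∧ TotallyBounded (univ : Set (X i))) ∧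
        {i | ¬ ConnectedSpace (X i)}.Finite)) := by
  classical
  refine ⟨fun i => hX.of_retract
    (uniformContinuous_pi_update (fun i => Classical.arbitrary (X i)) i)
    (Pi.uniformContinuous_proj X i) fun a => by simp, isULC_pi_iff.symm, ?_⟩
  by_cases hb : ∀ i, TotallyBounded (univ : Set (X i))
  · exact Or.inr (Or.inl hb)
  obtain ⟨j, hj⟩ := not_forall.1 hb
  obtain ⟨hULC, hfin⟩ := isULC_pi_iff.1 (hX.isULC_pi_ne hj)
  have hfin' : {i | ¬ ConnectedSpace (X i)}.Finite := by
    refine ((hfin.image Subtype.val).insert j).subset fun i hi => ?_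
    by_cases h : i = j
    · exact Or.inl h
    · exact Or.inr ⟨⟨i, h⟩, hi, rfl⟩
  by_cases hjU : IsULC (X j)
  · refine Or.inl ⟨fun i => ?_, hfin'⟩
    by_cases h : i = j
    · exact h ▸ hjU
    · exact hULC ⟨i, h⟩
  · refine Or.inr (Or.inr ⟨j, fun i hi => ⟨hULC ⟨i, hi⟩, ?_⟩, hfin'⟩)
    -- Exchange the roles: a non-precompact `X i` would make the product of the factors other than
    -- `i`, and hence `X j`, ULC.
    by_contra hti
    exact hjU ((isULC_pi_iff.1 (hX.isULC_pi_ne hti)).1 ⟨j, Ne.symm hi⟩)
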